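/- Let $\mathbf{KMet}$ be the category of compact metric spaces and non-expansive maps, $\mathbf{Meas}$ the category of measurable spaces and measurable maps, $(\mathcal G,\eta^{\mathcal G},\mu^{\mathcal G})$ the Giry monad of probability measures on $\mathbf{Meas}$ (push-forwards, Dirac measures, averaging), and $H:\mathbf{KMet}\to\mathbf{Meas}$ the functor assigning to a compact metric space its Borel $\sigma$-algebra. Let $\mathcal K$ be the Kantorovich monad on $\mathbf{KMet}$: $\mathcal KX$ is the set of Borel probability measures on $X$ with the metric $$d_{\mathcal KX}(p,q)=\sup\Bigl\{\Bigl|\int h\,dp-\int h\,dq\Bigr| : h:X\to[0,1]\text{ non-expansive}\Bigr\},$$ with push-forwards, Dirac measures and averaging; the identity on underlying sets gives $\alpha:H\mathcal K\to\mathcal GH$. A probability endofunctor is a pair $(S,\beta)$ with $S:\mathbf{KMet}\to\mathbf{KMet}$ a functor and $\beta:HS\to\mathcal GH$ a natural transformation; a morphism $(S,\beta)\to(S',\beta')$ is a natural transformation $\lambda:S\to S'$ with $\beta'\circ H\lambda=\beta$. Let $\mathcal N$ be the full subcategory of those $(S,\beta)$ for which $\beta_{[0,1]}$ is non-expansive as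 a map $S[0,1]\to\mathcal K[0,1]$. A Kleisli law is a natural transformation $\beta:HT\to\mathcal GH$, for a monad $T$ on $\mathbf{KMet}$, with $\beta\circ H\eta^T=\eta^{\mathcal G}_H$ and $\beta\circ H\mu^T=\mu^{\mathcal G}_H\circ\mathcal G\beta\circ\beta_T$. Let $2=\{0,1\}$ be the two-point space with $d(0,1)=1$. 1. $(\mathcal K,\alpha)$ belongs to $\mathcal N$ and is a terminal object of $\mathcal N$. 2. This generalises Van Breugel's terminality result. Namely, $\alpha$ is an isomorphism and a Kleisli law, and $p\mapsto p(\{0\})$ is an isomorphism $\mathcal K2\cong[0,1]$ in $\mathbf{KMet}$. If $T$ is any monad on $\mathbf{KMet}$ and $\beta:HT\to\mathcal GH$ is a Kleisli law such that $t\mapsto\beta_2(t)(\{0\})$ is an isomorphism $T2\cong[0,1]$ in $\mathbf{KMet}$, then $(T,\beta)$ belongs to $\mathcal N$, and there is a unique monad morphism $\varphi:T\to\mathcal K$ with $\alpha\circ H\varphi=\beta$. 3. For a metric space $X$ and Borel probability measures $p,q$ on $X$ let $$d_{PX}(p,q)=\inf\{\varepsilon>0 : p(A)\le q(A_\varepsilon)+\varepsilon\text{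 for all Borel }A\subseteq X\},$$ where $A_\varepsilon=\{x: d(x,A)\le\varepsilon\}$ and $\emptyset_\varepsilon=\emptyset$. Let $P:\mathbf{KMet}\to\mathbf{KMet}$ be the Prokhorov endofunctor, sending $X$ to the set of its Borel probability measures with the metric $d_{PX}$, and acting by push-forward. Then the identity on underlying sets is a natural isomorphism $\iota:HP\to\mathcal GH$, but $(P,\iota)$ does not belong to $\mathcal N$. 4. The inequality $d_{PX}\le d_{\mathcal KX}$ fails for $X=[0,1]$: for $p=\frac35\delta_0+\frac25\delta_1$ and $q=\frac35\delta_{1/2}+\frac25\delta_1$ one has $d_{\mathcal KX}(p,q)=\frac3{10}$ and $d_{PX}(p,q)=\frac12$. However, $d_{PX}^2\le d_{\mathcal KX}$ holds for every complete separable metric space $X$ (with $d_{\mathcal KX}$ defined by the same formula). -/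

import Mathlib

open CategoryTheory MeasureTheory

/-! ### Compact metric spaces and non-expansive maps -/

/-- Objects of `KMet`: compact metric spaces. -/
structure KMet : Type 1 where
  of ::
  carrier : Type
  [metric : MetricSpace carrier]
  [compact : CompactSpace carrier]

namespace KMet

instance : CoeSort KMet Type := ⟨carrier⟩

attribute [instance] KMet.metric KMet.compact

/-- Morphisms of `KMet`: non-expansive maps. -/
@[ext]
structure Hom (X Y : KMet) : Type where
  toFun : X → Y
  nonexpansive : LipschitzWith 1 toFun

instance (X Y : KMet) : FunLike (Hom X Y) X Y where
  coe f := f.toFun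
  coe_injective _ _ h := Hom.ext h

instance : LargeCategory KMet where
  Hom X Y := Hom X Y
  id _ := ⟨id, LipschitzWith.id⟩
  comp f g := ⟨g.toFun ∘ f.toFun, by simpa using g.nonexpansive.comp f.nonexpansive⟩

instance : ConcreteCategory KMet Hom where
  hom f := f
  ofHom f := f

/-- Every compact metric space carries its Borel σ-algebra. -/
instance (X : KMet) : MeasurableSpace X := borel X

instance (X : KMet) : BorelSpace X := ⟨rfl⟩

lemma Hom.measurable {X Y : KMet} (f : X ⟶ Y) : Measurable f.toFun :=
  f.nonexpansive.continuous.measurable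

/-- The unit interval with its usual metric. -/
def interval : KMet := of unitInterval

/-- The inclusion of `[0,1]` into the real numbers. -/
def coordinate (x : interval) : ℝ := ((show unitInterval from x) : ℝ)

/-- The discrete two-point space `{0, 1}`, with the two points at distance `1`. -/
def two : KMet := of ({0, 1} : Set ℝ)

/-- The point `0` of the two-point space. -/
def twoZero : two := (⟨0, by simp⟩ : ({0, 1} : Set ℝ))

end KMet

/-- The functor `H : KMet ⥤ Meas` which assigns to a compact metric space its Borel σ-algebra. -/
def borelFunctor : KMet ⥤ MeasCat where
  obj X := MeasCat.of X
  map f := ⟨f.toFun, KMet.Hom.measurable f⟩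

/-! ### The Giry monad of probability measures on measurable spaces -/

namespace Giry

variable {X Y Z : Type*} [MeasurableSpace X] [MeasurableSpace Y] [MeasurableSpace Z]

/-- Push-forward of probability measures along a measurable map. -/
noncomputable def pushforward (f : X → Y) (hf : Measurable f) (p : ProbabilityMeasure X) :
    ProbabilityMeasure Y :=
  p.map hf.aemeasurable

/-- The average of a probability measure on the space of probability measures:
`average P A = ∫ p A dP(p)`. -/
noncomputable def average (P : ProbabilityMeasure (ProbabilityMeasure X)) :
    ProbabilityMeasure X :=
  ⟨((P : Measure (ProbabilityMeasure X)).map ((↑) : ProbabilityMeasure X → Measure X)).join, by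
    have : IsProbabilityMeasure
        ((P : Measure (ProbabilityMeasure X)).map ((↑) : ProbabilityMeasure X → Measure X)) :=
      Measure.isProbabilityMeasure_map measurable_subtype_coe.aemeasurable
    refine isProbabilityMeasure_join ?_
    refine (ae_map_iff (f := ((↑) : ProbabilityMeasure X → Measure X))
      measurable_subtype_coe.aemeasurable
      ProbabilityMeasure.measurableSet_isProbabilityMeasure).2 ?_
    exact Filter.Eventually.of_forall fun p => p.2⟩

lemma measurable_toMeasure :
    Measurable ((↑) : ProbabilityMeasure X → Measure X) := measurable_subtype_coe

lemma measurable_eval {A : Set X} (hA : MeasurableSet A) :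
    Measurable fun p : ProbabilityMeasure X => (p : Measure X) A :=
  (Measure.measurable_coe hA).comp measurable_toMeasure

lemma toMeasure_average (P : ProbabilityMeasure (ProbabilityMeasure X)) :
    (average P : Measure X) =
      ((P : Measure (ProbabilityMeasure X)).map ((↑) : ProbabilityMeasure X → Measure X)).join :=
  rfl

lemma toMeasure_pushforward (f : X → Y) (hf : Measurable f) (p : ProbabilityMeasure X) :
    (pushforward f hf p : Measure Y) = (p : Measure X).map f := rfl

lemma average_apply (P : ProbabilityMeasure (ProbabilityMeasure X)) {A : Set X}
    (hA : MeasurableSet A) :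
    (average P : Measure X) A = ∫⁻ p, (p : Measure X) A ∂(P : Measure (ProbabilityMeasure X)) := by
  rw [toMeasure_average, Measure.join_apply hA,
    lintegral_map (Measure.measurable_coe hA) measurable_toMeasure]

lemma lintegral_average (P : ProbabilityMeasure (ProbabilityMeasure X)) {f : X → ENNReal}
    (hf : Measurable f) :
    ∫⁻ x, f x ∂(average P : Measure X) =
      ∫⁻ p, ∫⁻ x, f x ∂(p : Measure X) ∂(P : Measure (ProbabilityMeasure X)) := by
  rw [toMeasure_average, Measure.lintegral_join hf.aemeasurable,
    lintegral_map (Measure.measurable_lintegral hf) measurable_toMeasure]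

lemma ext_of_apply {p q : ProbabilityMeasure X}
    (h : ∀ A, MeasurableSet A → (p : Measure X) A = (q : Measure X) A) : p = q :=
  Subtype.ext (Measure.ext h)

lemma measurable_of_apply {f : Y → ProbabilityMeasure X}
    (h : ∀ A, MeasurableSet A → Measurable fun y => (f y : Measure X) A) : Measurable f :=
  Measurable.subtype_mk (Measure.measurable_of_measurable_coe _ h)

lemma measurable_pushforward (f : X → Y) (hf : Measurable f) :
    Measurable (pushforward f hf) :=
  Measurable.subtype_mk ((Measure.measurable_map f hf).comp measurable_toMeasure)

lemma measurable_average : Measurable (average : _ → ProbabilityMeasure X) :=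
  measurable_of_apply fun A hA => by
    simp only [average_apply _ hA]
    exact (Measure.measurable_lintegral
      ((Measure.measurable_coe hA).comp measurable_toMeasure)).comp measurable_toMeasure

lemma measurable_diracProba : Measurable (diracProba : X → ProbabilityMeasure X) :=
  Measurable.subtype_mk Measure.measurable_dirac

lemma pushforward_id (p : ProbabilityMeasure X) : pushforward id measurable_id p = p :=
  Subtype.ext Measure.map_id

lemma pushforward_pushforward {f : X → Y} (hf : Measurable f) {g : Y → Z} (hg : Measurable g)
    (p : ProbabilityMeasure X) :
    pushforward g hg (pushforward f hf p) = pushforward (g ∘ f) (hg.comp hf) p :=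
  Subtype.ext (Measure.map_map hg hf)

lemma pushforward_dirac {f : X → Y} (hf : Measurable f) (x : X) :
    pushforward f hf (diracProba x) = diracProba (f x) :=
  Subtype.ext (Measure.map_dirac' hf x)

lemma average_pushforward {f : X → Y} (hf : Measurable f)
    (P : ProbabilityMeasure (ProbabilityMeasure X)) :
    average (pushforward (pushforward f hf) (measurable_pushforward f hf) P) =
      pushforward f hf (average P) :=
  ext_of_apply fun A hA => by
    rw [average_apply _ hA, toMeasure_pushforward, toMeasure_pushforward,
      Measure.map_apply hf hA, average_apply _ (hf hA), lintegral_map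
        (measurable_eval hA) (measurable_pushforward f hf)]
    simp only [toMeasure_pushforward, Measure.map_apply hf hA]

lemma average_dirac (p : ProbabilityMeasure X) : average (diracProba p) = p :=
  ext_of_apply fun A hA => by
    rw [average_apply _ hA]
    exact lintegral_dirac' p (measurable_eval hA)

lemma average_pushforward_dirac (p : ProbabilityMeasure X) :
    average (pushforward diracProba measurable_diracProba p) = p :=
  ext_of_apply fun A hA => by
    rw [average_apply _ hA, toMeasure_pushforward, lintegral_map
        (measurable_eval hA) measurable_diracProba]
    simp only [diracProba_toMeasure_apply' _ hA]
    exact lintegral_indicator_one hA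

lemma average_pushforward_average
    (P : ProbabilityMeasure (ProbabilityMeasure (ProbabilityMeasure X))) :
    average (pushforward average measurable_average P) = average (average P) :=
  ext_of_apply fun A hA => by
    have h := measurable_eval (X := X) hA
    rw [average_apply _ hA, toMeasure_pushforward, lintegral_map h measurable_average,
      average_apply _ hA]
    simp only [average_apply _ hA]
    exact (lintegral_average P h).symm

/-- The Giry monad: `G X` is the set of probability measures on `X` with the coarsest σ-algebra
making all evaluations `p ↦ p A` measurable, with push-forwards, Dirac measures as unit and
averaging as multiplication. -/
noncomputable def monad : Monad MeasCat where
  obj X := MeasCat.of (ProbabilityMeasure X)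
  map f := ⟨pushforward f.1 f.2, measurable_pushforward f.1 f.2⟩
  map_id _ := Subtype.ext (funext fun p => pushforward_id p)
  map_comp f g := Subtype.ext (funext fun p => (pushforward_pushforward f.2 g.2 p).symm)
  η :=
    { app X := ⟨fun x : X => diracProba x, measurable_diracProba⟩
      naturality _ _ f := Subtype.ext (funext fun x => (pushforward_dirac f.2 x).symm) }
  μ :=
    { app X := ⟨fun P : ProbabilityMeasure (ProbabilityMeasure X) => average P,
        measurable_average⟩
      naturality _ _ f := Subtype.ext (funext fun P => average_pushforward f.2 P) }
  assoc _ := Subtype.ext (funext fun P => average_pushforward_average P)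
  left_unit _ := Subtype.ext (funext fun p => average_dirac p)
  right_unit _ := Subtype.ext (funext fun p => average_pushforward_dirac p)

end Giry

/-! ### The Kantorovich and Prokhorov distances -/

section Distances

set_option linter.unusedSectionVars false

variable {X : Type*} [MetricSpace X] [MeasurableSpace X]

/-- The Kantorovich distance:
`sup { |∫ h dp - ∫ h dq| : h : X → [0,1] non-expansive }`. -/
noncomputable def kantorovichDist (p q : ProbabilityMeasure X) : ℝ :=
  sSup {r | ∃ h : X → ℝ, LipschitzWith 1 h ∧ (∀ x, h x ∈ Set.Icc (0 : ℝ) 1) ∧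
    r = |∫ x, h x ∂(p : Measure X) - ∫ x, h x ∂(q : Measure X)|}

/-- The Prokhorov distance: the infimum of all `α > 0` such that `p A ≤ q (A_α) + α` for every
Borel set `A`, where `A_α = {x : d(x, A) ≤ α}` (which is empty if `A` is empty). -/
noncomputable def prokhorovDist (p q : ProbabilityMeasure X) : ℝ :=
  sInf {α : ℝ | 0 < α ∧ ∀ A : Set X, MeasurableSet A →
    (p : Measure X) A ≤ (q : Measure X) (Metric.cthickening α A) + ENNReal.ofReal α}

variable [BorelSpace X]

lemma integral_mem_Icc (p : ProbabilityMeasure X) {h : X → ℝ}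
    (hh : ∀ x, h x ∈ Set.Icc (0 : ℝ) 1) : ∫ x, h x ∂(p : Measure X) ∈ Set.Icc (0 : ℝ) 1 := by
  refine ⟨integral_nonneg fun x => (hh x).1, ?_⟩
  have := norm_integral_le_of_norm_le_const (μ := (p : Measure X)) (f := h) (C := 1)
    (Filter.Eventually.of_forall fun x => by
      rw [Real.norm_eq_abs, abs_le]; exact ⟨by linarith [(hh x).1], (hh x).2⟩)
  simp only [probReal_univ, mul_one] at this
  exact (le_abs_self _).trans this

lemma bddAbove_kantorovich (p q : ProbabilityMeasure X) :
    BddAbove {r | ∃ h : X → ℝ, LipschitzWith 1 h ∧ (∀ x, h x ∈ Set.Icc (0 : ℝ) 1) ∧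
      r = |∫ x, h x ∂(p : Measure X) - ∫ x, h x ∂(q : Measure X)|} := by
  refine ⟨1, ?_⟩
  rintro r ⟨h, -, hh, rfl⟩
  have h1 := integral_mem_Icc p hh
  have h2 := integral_mem_Icc q hh
  rw [abs_le]
  constructor <;> linarith [h1.1, h1.2, h2.1, h2.2]

lemma abs_integral_sub_le_kantorovichDist (p q : ProbabilityMeasure X) {h : X → ℝ}
    (hl : LipschitzWith 1 h) (hh : ∀ x, h x ∈ Set.Icc (0 : ℝ) 1) :
    |∫ x, h x ∂(p : Measure X) - ∫ x, h x ∂(q : Measure X)| ≤ kantorovichDist p q :=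
  le_csSup (bddAbove_kantorovich p q) ⟨h, hl, hh, rfl⟩

lemma kantorovichDist_le {p q : ProbabilityMeasure X} {c : ℝ}
    (H : ∀ h : X → ℝ, LipschitzWith 1 h → (∀ x, h x ∈ Set.Icc (0 : ℝ) 1) →
      |∫ x, h x ∂(p : Measure X) - ∫ x, h x ∂(q : Measure X)| ≤ c) :
    kantorovichDist p q ≤ c := by
  refine csSup_le ⟨_, fun _ => 0, LipschitzWith.const' 0, by simp, rfl⟩ ?_
  rintro r ⟨h, hl, hh, rfl⟩
  exact H h hl hh

lemma kantorovichDist_self (p : ProbabilityMeasure X) : kantorovichDist p p = 0 :=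
  le_antisymm (kantorovichDist_le fun h _ _ => by simp)
    ((abs_nonneg _).trans
      (abs_integral_sub_le_kantorovichDist p p (h := fun _ => 0) (LipschitzWith.const' 0)
        (by simp)))

lemma kantorovichDist_comm (p q : ProbabilityMeasure X) :
    kantorovichDist p q = kantorovichDist q p := by
  simp only [kantorovichDist, abs_sub_comm]

lemma kantorovichDist_triangle (p q r : ProbabilityMeasure X) :
    kantorovichDist p r ≤ kantorovichDist p q + kantorovichDist q r :=
  kantorovichDist_le fun _ hl hh => (abs_sub_le _ _ _).trans
    (add_le_add (abs_integral_sub_le_kantorovichDist p q hl hh)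
      (abs_integral_sub_le_kantorovichDist q r hl hh))

/-- The Kantorovich distance controls the integrals of all bounded Lipschitz functions. -/
lemma abs_integral_sub_le_mul_kantorovichDist {f : X → ℝ} {C : ℝ}
    (hC : ∀ x y, dist (f x) (f y) ≤ C) {L : NNReal} (hL : LipschitzWith L f) :
    ∃ c : ℝ, ∀ p q : ProbabilityMeasure X,
      |∫ x, f x ∂(p : Measure X) - ∫ x, f x ∂(q : Measure X)| ≤ c * kantorovichDist p q := by
  set M : ℝ := 2 * (1 + |C| + L) with hM
  have hMpos : 0 < M := by positivity
  refine ⟨M, fun p q => ?_⟩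
  obtain ⟨x₀⟩ := p.nonempty
  set g : X → ℝ := fun x => f x / M + (1 / 2 - f x₀ / M) with hg
  have key : ∀ x y, |f x - f y| ≤ M / 2 := fun x y =>
    (hC x y).trans (by rw [hM]; linarith [le_abs_self C, L.coe_nonneg])
  have hgl : LipschitzWith 1 g := by
    refine LipschitzWith.of_dist_le_mul fun x y => ?_
    have h1 : dist (g x) (g y) = dist (f x) (f y) / M := by
      simp only [hg, Real.dist_eq, add_sub_add_right_eq_sub, ← sub_div, abs_div,
        abs_of_pos hMpos]
    rw [h1, div_le_iff₀ hMpos, NNReal.coe_one, one_mul]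
    refine (hL.dist_le_mul x y).trans ?_
    rw [mul_comm]
    refine mul_le_mul_of_nonneg_left ?_ dist_nonneg
    rw [hM]; linarith [abs_nonneg C, L.coe_nonneg]
  have hgi : ∀ x, g x ∈ Set.Icc (0 : ℝ) 1 := fun x => by
    have h2 : g x = 1 / 2 + (f x - f x₀) / M := by simp only [hg]; ring
    have h3 : |(f x - f x₀) / M| ≤ 1 / 2 := by
      rw [abs_div, abs_of_pos hMpos, div_le_iff₀ hMpos]; linarith [key x x₀]
    rw [abs_le] at h3
    rw [h2]; constructor <;> linarith [h3.1, h3.2]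
  have hfi : ∀ r : ProbabilityMeasure X, Integrable f (r : Measure X) := fun r =>
    Integrable.of_bound hL.continuous.measurable.aestronglyMeasurable (|f x₀| + M / 2)
      (Filter.Eventually.of_forall fun x => by
        rw [Real.norm_eq_abs]
        calc |f x| = |f x₀ + (f x - f x₀)| := by ring_nf
          _ ≤ _ := (abs_add_le _ _).trans (by gcongr; exact key x x₀))
  have hint : ∀ r : ProbabilityMeasure X,
      ∫ x, g x ∂(r : Measure X) = (∫ x, f x ∂(r : Measure X)) / M + (1 / 2 - f x₀ / M) :=
    fun r => by
      simp only [hg]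
      rw [integral_add ((hfi r).div_const M) (integrable_const _), integral_div]
      simp
  have := abs_integral_sub_le_kantorovichDist p q hgl hgi
  rw [hint, hint, add_sub_add_right_eq_sub, ← sub_div, abs_div, abs_of_pos hMpos,
    div_le_iff₀ hMpos] at this
  linarith

lemma eq_of_kantorovichDist_eq_zero {p q : ProbabilityMeasure X}
    (h : kantorovichDist p q = 0) : p = q := by
  have : Filter.Tendsto (fun _ : ℕ => p) Filter.atTop (nhds q) := by
    rw [tendsto_iff_forall_lipschitz_integral_tendsto]
    rintro f ⟨C, hC⟩ ⟨L, hL⟩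
    obtain ⟨c, hc⟩ := abs_integral_sub_le_mul_kantorovichDist hC hL
    have := hc p q
    rw [h, mul_zero] at this
    rw [sub_eq_zero.1 (abs_nonpos_iff.1 this)]
    exact tendsto_const_nhds
  exact tendsto_nhds_unique tendsto_const_nhds this

lemma integral_le_add_levyProkhorovDist (p q : ProbabilityMeasure X) {h : X → ℝ}
    (hl : LipschitzWith 1 h) (hh : ∀ x, h x ∈ Set.Icc (0 : ℝ) 1) {ε : ℝ} (hε : 0 < ε)
    (hpq : levyProkhorovEDist (p : Measure X) q < ENNReal.ofReal ε) :
    ∫ x, h x ∂(p : Measure X) ≤ ∫ x, h x ∂(q : Measure X) + 2 * ε := by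
  set f : BoundedContinuousFunction X ℝ := BoundedContinuousFunction.ofNormedAddCommGroup h
    hl.continuous 1 (fun x => by
      rw [Real.norm_eq_abs, abs_le]; exact ⟨by linarith [(hh x).1], (hh x).2⟩) with hf
  set g : BoundedContinuousFunction X ℝ := BoundedContinuousFunction.ofNormedAddCommGroup
    (fun x => h x + ε) (hl.continuous.add continuous_const) (1 + ε) (fun x => by
      rw [Real.norm_eq_abs, abs_le]; constructor <;> linarith [(hh x).1, (hh x).2]) with hg
  have hf1 : ‖f‖ ≤ 1 := BoundedContinuousFunction.norm_ofNormedAddCommGroup_le _ zero_le_one _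
  have hfg : ‖f‖ ≤ ‖g‖ := by
    refine (BoundedContinuousFunction.norm_le (norm_nonneg _)).2 fun x => ?_
    refine le_trans ?_ (g.norm_coe_le_norm x)
    change ‖h x‖ ≤ ‖h x + ε‖
    rw [Real.norm_of_nonneg (hh x).1, Real.norm_of_nonneg (by linarith [(hh x).1])]
    linarith
  have hb := BoundedContinuousFunction.integral_le_of_levyProkhorovEDist_lt (p : Measure X) q hε
    hpq f (Filter.Eventually.of_forall fun x => (hh x).1)
  have hgq := BoundedContinuousFunction.integral_eq_integral_meas_le g (q : Measure X)
    (Filter.Eventually.of_forall fun x => show (0 : ℝ) ≤ h x + ε by linarith [(hh x).1])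
  have hint : ∫ x, g x ∂(q : Measure X) = ∫ x, h x ∂(q : Measure X) + ε := by
    change ∫ x, h x + ε ∂(q : Measure X) = _
    have hi : Integrable h (q : Measure X) := f.integrable _
    rw [integral_add hi (integrable_const _)]
    simp
  have hbd : ∀ (u : ℝ → Set X) (K : ℝ), (∀ s t, s ≤ t → u t ⊆ u s) →
      IntegrableOn (fun t => (q : Measure X).real (u t)) (Set.Ioc 0 K) := fun u K hu =>
    Measure.integrableOn_of_bounded (M := 1) measure_Ioc_lt_top.ne
      (Measurable.ennreal_toReal
        (Antitone.measurable fun s t hst => measure_mono (hu s t hst))).aestronglyMeasurable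
      (Filter.Eventually.of_forall fun t => by
        rw [Real.norm_of_nonneg measureReal_nonneg]; exact measureReal_le_one)
  have h1 : ∫ t in Set.Ioc 0 ‖f‖, (q : Measure X).real (Metric.thickening ε {a | t ≤ f a}) ≤
      ∫ t in Set.Ioc 0 ‖f‖, (q : Measure X).real {a | t ≤ g a} := by
    refine setIntegral_mono
      (hbd _ _ fun s t hst => Metric.thickening_subset_of_subset ε fun a ha => hst.trans ha)
      (hbd _ _ fun s t hst a ha => hst.trans ha) fun t => ?_
    refine measureReal_mono fun x hx => ?_
    obtain ⟨z, hz, hxz⟩ := Metric.mem_thickening_iff.1 hx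
    have hd := hl.dist_le_mul x z
    rw [Real.dist_eq, NNReal.coe_one, one_mul] at hd
    have hz' : t ≤ h z := hz
    change t ≤ h x + ε
    linarith [neg_abs_le (h x - h z)]
  have h2 : ∫ t in Set.Ioc 0 ‖f‖, (q : Measure X).real {a | t ≤ g a} ≤
      ∫ t in Set.Ioc 0 ‖g‖, (q : Measure X).real {a | t ≤ g a} :=
    setIntegral_mono_set (hbd _ _ fun s t hst a ha => hst.trans ha)
      (Filter.Eventually.of_forall fun t => measureReal_nonneg)
      (LE.le.eventuallyLE (Set.Ioc_subset_Ioc_right hfg))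
  have h3 : ε * ‖f‖ ≤ ε := by nlinarith
  change ∫ x, h x ∂(p : Measure X) ≤ _ at hb
  linarith

lemma kantorovichDist_le_two_mul_levyProkhorovDist (p q : ProbabilityMeasure X) :
    kantorovichDist p q ≤ 2 * levyProkhorovDist (p : Measure X) q := by
  refine kantorovichDist_le fun h hl hh => le_of_forall_pos_le_add fun δ hδ => ?_
  have hd : 0 ≤ levyProkhorovDist (p : Measure X) q := ENNReal.toReal_nonneg
  have hlt : levyProkhorovEDist (p : Measure X) q <
      ENNReal.ofReal (levyProkhorovDist (p : Measure X) q + δ / 2) := by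
    rw [ENNReal.lt_ofReal_iff_toReal_lt (levyProkhorovEDist_ne_top _ _)]
    exact lt_add_of_pos_right _ (half_pos hδ)
  have h1 := integral_le_add_levyProkhorovDist p q hl hh (by positivity) hlt
  have h2 := integral_le_add_levyProkhorovDist q p hl hh (by positivity)
    (levyProkhorovEDist_comm (p : Measure X) q ▸ hlt)
  rw [abs_le]
  constructor <;> linarith

/-- For probability measures, the one-sided infimum with closed thickenings agrees with Mathlib's
two-sided infimum with open thickenings. -/
lemma prokhorovDist_eq_levyProkhorovDist (p q : ProbabilityMeasure X) :
    prokhorovDist p q = levyProkhorovDist (p : Measure X) q := by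
  have hd : 0 ≤ levyProkhorovDist (p : Measure X) q := ENNReal.toReal_nonneg
  have hmem : ∀ α, levyProkhorovDist (p : Measure X) q < α → 0 < α ∧ ∀ A : Set X,
      MeasurableSet A →
      (p : Measure X) A ≤ (q : Measure X) (Metric.cthickening α A) + ENNReal.ofReal α := by
    intro α hα
    refine ⟨hd.trans_lt hα, fun A hA => ?_⟩
    have hlt : levyProkhorovEDist (p : Measure X) q < ENNReal.ofReal α := by
      rwa [ENNReal.lt_ofReal_iff_toReal_lt (levyProkhorovEDist_ne_top _ _)]
    have := left_measure_le_of_levyProkhorovEDist_lt hlt hA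
    rw [ENNReal.toReal_ofReal (hd.trans hα.le)] at this
    exact this.trans (by gcongr; exact Metric.thickening_subset_cthickening _ _)
  have hbdd : BddBelow {α : ℝ | 0 < α ∧ ∀ A : Set X, MeasurableSet A →
      (p : Measure X) A ≤ (q : Measure X) (Metric.cthickening α A) + ENNReal.ofReal α} :=
    ⟨0, fun α hα => hα.1.le⟩
  refine le_antisymm (le_of_forall_gt_imp_ge_of_dense fun α hα => csInf_le hbdd (hmem α hα)) ?_
  refine le_csInf ⟨_, hmem _ (lt_add_one _)⟩ fun α hα => ?_
  refine levyProkhorovDist_le_of_forall_le _ _ hα.1.le fun ε B hε hB => ?_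
  refine (hα.2 B hB).trans ?_
  gcongr
  exact Metric.cthickening_subset_thickening' (hα.1.trans hε) hε B

end Distances

/-! ### Spaces of probability measures with these distances -/

/-- The set of Borel probability measures on `X`, to be equipped with the Kantorovich metric. -/
@[ext]
structure KantorovichSpace (X : Type*) [MeasurableSpace X] where
  toProb : ProbabilityMeasure X

/-- The set of Borel probability measures on `X`, to be equipped with the Prokhorov metric. -/
@[ext]
structure ProkhorovSpace (X : Type*) [MeasurableSpace X] where
  toProb : ProbabilityMeasure X

section Spaces

variable {X : Type*} [MetricSpace X] [MeasurableSpace X] [BorelSpace X]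

noncomputable instance : MetricSpace (KantorovichSpace X) where
  dist p q := kantorovichDist p.toProb q.toProb
  dist_self p := kantorovichDist_self p.toProb
  dist_comm p q := kantorovichDist_comm p.toProb q.toProb
  dist_triangle p q r := kantorovichDist_triangle p.toProb q.toProb r.toProb
  eq_of_dist_eq_zero h := KantorovichSpace.ext (eq_of_kantorovichDist_eq_zero h)

lemma KantorovichSpace.dist_def (p q : KantorovichSpace X) :
    dist p q = kantorovichDist p.toProb q.toProb := rfl

noncomputable instance : MetricSpace (ProkhorovSpace X) where
  dist p q := prokhorovDist p.toProb q.toProb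
  dist_self p := by
    rw [prokhorovDist_eq_levyProkhorovDist, levyProkhorovDist_self]
  dist_comm p q := by
    simp only [prokhorovDist_eq_levyProkhorovDist, levyProkhorovDist_comm]
  dist_triangle p q r := by
    simp only [prokhorovDist_eq_levyProkhorovDist]
    exact levyProkhorovDist_triangle _ _ _
  eq_of_dist_eq_zero {p q} h := by
    have h' : dist (LevyProkhorov.ofMeasure p.toProb) (LevyProkhorov.ofMeasure q.toProb) = 0 := by
      rw [LevyProkhorov.dist_probabilityMeasure_def, ← prokhorovDist_eq_levyProkhorovDist]
      exact h
    exact ProkhorovSpace.ext (congrArg LevyProkhorov.toMeasure (eq_of_dist_eq_zero h'))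

lemma ProkhorovSpace.dist_def (p q : ProkhorovSpace X) :
    dist p q = prokhorovDist p.toProb q.toProb := rfl

lemma KantorovichSpace.continuous_toProb :
    Continuous (KantorovichSpace.toProb : KantorovichSpace X → ProbabilityMeasure X) := by
  rw [continuous_iff_continuousAt]
  intro q
  rw [ContinuousAt, tendsto_iff_forall_lipschitz_integral_tendsto]
  rintro f ⟨C, hC⟩ ⟨L, hL⟩
  obtain ⟨c, hc⟩ := abs_integral_sub_le_mul_kantorovichDist hC hL
  rw [tendsto_iff_dist_tendsto_zero]
  refine squeeze_zero (fun _ => dist_nonneg) (fun p => hc p.toProb q.toProb) ?_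
  have h : Filter.Tendsto (fun p : KantorovichSpace X => c * dist p q) (nhds q)
      (nhds (c * dist q q)) :=
    (continuous_const.mul (continuous_id.dist continuous_const)).tendsto q
  rw [dist_self, mul_zero] at h
  exact h

/-- The Prokhorov space is isometric to Mathlib's Lévy-Prokhorov space. -/
lemma ProkhorovSpace.isometry_ofMeasure :
    Isometry fun p : ProkhorovSpace X => LevyProkhorov.ofMeasure p.toProb :=
  Isometry.of_dist_eq fun p q => by
    rw [LevyProkhorov.dist_probabilityMeasure_def, ← prokhorovDist_eq_levyProkhorovDist]
    rfl

lemma ProkhorovSpace.continuous_toProb :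
    Continuous (ProkhorovSpace.toProb : ProkhorovSpace X → ProbabilityMeasure X) :=
  LevyProkhorov.continuous_toMeasure_probabilityMeasure.comp
    ProkhorovSpace.isometry_ofMeasure.continuous

instance [CompactSpace X] : CompactSpace (LevyProkhorov (ProbabilityMeasure X)) :=
  (LevyProkhorov.probabilityMeasureHomeomorph (Ω := X)).compactSpace

instance [CompactSpace X] : CompactSpace (KantorovichSpace X) := by
  have hl : LipschitzWith 2 fun p : LevyProkhorov (ProbabilityMeasure X) =>
      KantorovichSpace.mk p.toMeasure :=
    LipschitzWith.of_dist_le_mul fun p q =>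
      kantorovichDist_le_two_mul_levyProkhorovDist p.toMeasure q.toMeasure
  exact Function.Surjective.compactSpace hl.continuous
    fun p => ⟨LevyProkhorov.ofMeasure p.toProb, rfl⟩

instance [CompactSpace X] : CompactSpace (ProkhorovSpace X) := by
  have hi : Isometry fun p : LevyProkhorov (ProbabilityMeasure X) =>
      ProkhorovSpace.mk p.toMeasure :=
    Isometry.of_dist_eq fun p q => prokhorovDist_eq_levyProkhorovDist p.toMeasure q.toMeasure
  exact Function.Surjective.compactSpace hi.continuous
    fun p => ⟨LevyProkhorov.ofMeasure p.toProb, rfl⟩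

/-- A map into probability measures that is continuous for weak convergence is measurable for the
σ-algebra generated by the evaluations. -/
lemma measurable_of_continuous_toProb {Y : Type*} [TopologicalSpace Y] [MeasurableSpace Y]
    [OpensMeasurableSpace Y] {f : Y → ProbabilityMeasure X} (hf : Continuous f) :
    Measurable f := by
  refine Measurable.subtype_mk (f := fun y => ((f y : ProbabilityMeasure X) : Measure X)) ?_
  refine Measurable.measure_of_isPiSystem_of_isProbabilityMeasure
    (BorelSpace.measurable_eq (α := X) |>.trans borel_eq_generateFrom_isClosed)
    isPiSystem_isClosed fun F hF => ?_
  have hF' : IsClosed F := hF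
  have h1 : ∀ n, Measurable fun y => ∫⁻ x, (hF'.apprSeq n x : ENNReal) ∂(f y : Measure X) :=
    fun n => ((ProbabilityMeasure.continuous_lintegral_boundedContinuousFunction
      (hF'.apprSeq n)).comp hf).measurable
  exact measurable_of_tendsto_metrizable h1 (tendsto_pi_nhds.2 fun y =>
    HasOuterApproxClosed.tendsto_lintegral_apprSeq hF' (f y : Measure X))

end Spaces

/-! ### The Kantorovich monad on `KMet` -/

section BorelInstances

variable {X : Type*} [MetricSpace X] [MeasurableSpace X] [BorelSpace X]

noncomputable instance : MeasurableSpace (KantorovichSpace X) := borel _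

instance : BorelSpace (KantorovichSpace X) := ⟨rfl⟩

noncomputable instance : MeasurableSpace (ProkhorovSpace X) := borel _

instance : BorelSpace (ProkhorovSpace X) := ⟨rfl⟩

end BorelInstances

namespace Kantorovich

lemma measurable_toProb (X : KMet) :
    Measurable (KantorovichSpace.toProb :
      KMet.of (KantorovichSpace X) → ProbabilityMeasure X) :=
  measurable_of_continuous_toProb (Y := KMet.of (KantorovichSpace X))
    KantorovichSpace.continuous_toProb

lemma integral_pushforward {X Y : KMet} (f : X ⟶ Y) (p : ProbabilityMeasure X) {h : Y → ℝ}
    (hl : LipschitzWith 1 h) :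
    ∫ y, h y ∂(Giry.pushforward f.toFun (KMet.Hom.measurable f) p : Measure Y) =
      ∫ x, h (f.toFun x) ∂(p : Measure X) :=
  integral_map (KMet.Hom.measurable f).aemeasurable
    hl.continuous.measurable.aestronglyMeasurable

/-- Push-forward of measures as a non-expansive map. -/
noncomputable def map {X Y : KMet} (f : X ⟶ Y) :
    KMet.of (KantorovichSpace X) ⟶ KMet.of (KantorovichSpace Y) :=
  ⟨fun p => ⟨Giry.pushforward f.toFun (KMet.Hom.measurable f) p.toProb⟩,
    LipschitzWith.of_dist_le_mul fun p q => by
      rw [NNReal.coe_one, one_mul]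
      refine kantorovichDist_le fun h hl hh => ?_
      rw [integral_pushforward f _ hl, integral_pushforward f _ hl]
      exact abs_integral_sub_le_kantorovichDist p.toProb q.toProb
        (by simpa [Function.comp_def] using hl.comp f.nonexpansive) fun x => hh _⟩

/-- Dirac measures as a non-expansive map. -/
noncomputable def dirac (X : KMet) : X ⟶ KMet.of (KantorovichSpace X) :=
  ⟨fun x => ⟨diracProba x⟩, LipschitzWith.of_dist_le_mul fun x y => by
    rw [NNReal.coe_one, one_mul]
    refine kantorovichDist_le fun h hl _ => ?_
    have hd : ∀ z : X, ∫ x, h x ∂(diracProba z : Measure X) = h z := fun z =>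
      integral_dirac h z
    rw [hd, hd]
    simpa [Real.dist_eq] using hl.dist_le_mul x y⟩

lemma integral_average {X : KMet} (P : KMet.of (KantorovichSpace (KMet.of (KantorovichSpace X))))
    {h : X → ℝ} (hl : LipschitzWith 1 h) (hh : ∀ x, h x ∈ Set.Icc (0 : ℝ) 1) :
    ∫ x, h x ∂(Giry.average (Giry.pushforward _ (measurable_toProb X) P.toProb) : Measure X) =
      ∫ p : KMet.of (KantorovichSpace X), (∫ x, h x ∂(p.toProb : Measure X))
        ∂(P.toProb : Measure (KMet.of (KantorovichSpace X))) := by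
  have hm : Measurable fun x => ENNReal.ofReal (h x) :=
    ENNReal.measurable_ofReal.comp hl.continuous.measurable
  have hi : ∀ p : ProbabilityMeasure X, ∫ x, h x ∂(p : Measure X) =
      (∫⁻ x, ENNReal.ofReal (h x) ∂(p : Measure X)).toReal := fun p =>
    integral_eq_lintegral_of_nonneg_ae (Filter.Eventually.of_forall fun x => (hh x).1)
      hl.continuous.measurable.aestronglyMeasurable
  have hg : Measurable fun p : ProbabilityMeasure X =>
      ∫⁻ x, ENNReal.ofReal (h x) ∂(p : Measure X) :=
    (Measure.measurable_lintegral hm).comp Giry.measurable_toMeasure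
  have hfin : ∀ p : ProbabilityMeasure X,
      ∫⁻ x, ENNReal.ofReal (h x) ∂(p : Measure X) < ⊤ := fun p => by
    refine lt_of_le_of_lt (lintegral_mono (g := fun _ => 1) fun x => ?_) (by simp)
    exact ENNReal.ofReal_le_one.2 (hh x).2
  rw [hi, Giry.lintegral_average _ hm, Giry.toMeasure_pushforward,
    lintegral_map hg (measurable_toProb X)]
  simp only [hi]
  exact (integral_toReal (hg.comp (measurable_toProb X)).aemeasurable
    (Filter.Eventually.of_forall fun p => hfin p.toProb)).symm

/-- Averaging of measures on measures as a non-expansive map. -/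
noncomputable def average (X : KMet) :
    KMet.of (KantorovichSpace (KMet.of (KantorovichSpace X))) ⟶ KMet.of (KantorovichSpace X) :=
  ⟨fun P => ⟨Giry.average (Giry.pushforward KantorovichSpace.toProb (measurable_toProb X)
      P.toProb)⟩, LipschitzWith.of_dist_le_mul fun P Q => by
    rw [NNReal.coe_one, one_mul]
    refine kantorovichDist_le fun h hl hh => ?_
    rw [integral_average P hl hh, integral_average Q hl hh]
    exact abs_integral_sub_le_kantorovichDist P.toProb Q.toProb
      (h := fun p : KMet.of (KantorovichSpace X) => ∫ x, h x ∂(p.toProb : Measure X))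
      (LipschitzWith.of_dist_le_mul fun p q => by
        rw [NNReal.coe_one, one_mul, Real.dist_eq]
        exact abs_integral_sub_le_kantorovichDist p.toProb q.toProb hl hh)
      fun p => integral_mem_Icc p.toProb hh⟩

/-- The Kantorovich monad: `K X` is the set of Borel probability measures on `X` with the
Kantorovich metric, with push-forwards, Dirac measures as unit and averaging as multiplication. -/
noncomputable def monad : Monad KMet where
  obj X := KMet.of (KantorovichSpace X)
  map f := map f
  map_id _ := KMet.Hom.ext (funext fun p =>
    KantorovichSpace.ext (Giry.pushforward_id p.toProb))
  map_comp f g := KMet.Hom.ext (funext fun p => KantorovichSpace.ext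
    (Giry.pushforward_pushforward (KMet.Hom.measurable f) (KMet.Hom.measurable g) p.toProb).symm)
  η :=
    { app X := dirac X
      naturality _ _ f := KMet.Hom.ext (funext fun x => KantorovichSpace.ext
        (Giry.pushforward_dirac (KMet.Hom.measurable f) x).symm) }
  μ :=
    { app X := average X
      naturality X Y f := KMet.Hom.ext (funext fun P => KantorovichSpace.ext <| by
        refine Eq.trans ?_ (Giry.average_pushforward (KMet.Hom.measurable f)
          (Giry.pushforward _ (measurable_toProb X) P.toProb))
        exact congrArg Giry.average
          ((Giry.pushforward_pushforward (KMet.Hom.measurable (map f))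
            (measurable_toProb Y) P.toProb).trans
          (Giry.pushforward_pushforward (measurable_toProb X)
            (Giry.measurable_pushforward _ (KMet.Hom.measurable f)) P.toProb).symm)) }
  assoc X := KMet.Hom.ext (funext fun P => KantorovichSpace.ext <| by
    have hT := measurable_toProb X
    have hK := measurable_toProb (KMet.of (KantorovichSpace X))
    let R := Giry.pushforward _ hK P.toProb
    have h1 : Giry.pushforward _ hT (Giry.pushforward _ (KMet.Hom.measurable (average X))
        P.toProb) = Giry.pushforward _ Giry.measurable_average
          (Giry.pushforward _ (Giry.measurable_pushforward _ hT) R) :=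
      (Giry.pushforward_pushforward (KMet.Hom.measurable (average X)) hT P.toProb).trans
        ((congrArg (Giry.pushforward _ Giry.measurable_average)
            (Giry.pushforward_pushforward hK (Giry.measurable_pushforward _ hT)
              P.toProb)).trans
          (Giry.pushforward_pushforward ((Giry.measurable_pushforward _ hT).comp hK)
            Giry.measurable_average P.toProb)).symm
    exact (congrArg Giry.average h1).trans ((Giry.average_pushforward_average _).trans
      (congrArg Giry.average (Giry.average_pushforward hT R))))
  left_unit X := KMet.Hom.ext (funext fun p => KantorovichSpace.ext <|
    (congrArg Giry.average (Giry.pushforward_dirac (measurable_toProb X) p)).trans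
      (Giry.average_dirac p.toProb))
  right_unit X := KMet.Hom.ext (funext fun p => KantorovichSpace.ext <|
    (congrArg Giry.average (Giry.pushforward_pushforward (KMet.Hom.measurable (dirac X))
      (measurable_toProb X) p.toProb)).trans (Giry.average_pushforward_dirac p.toProb))

/-- The natural transformation `H K ⟶ G H` which is the identity on the sets of Borel
probability measures. -/
noncomputable def toGiry :
    monad.toFunctor ⋙ borelFunctor ⟶ borelFunctor ⋙ Giry.monad.toFunctor where
  app X := ⟨KantorovichSpace.toProb, measurable_toProb X⟩
  naturality _ _ _ := rfl

end Kantorovich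

/-! ### The Prokhorov endofunctor on `KMet` -/

namespace Prokhorov

lemma measurable_toProb (X : KMet) :
    Measurable (ProkhorovSpace.toProb : KMet.of (ProkhorovSpace X) → ProbabilityMeasure X) :=
  measurable_of_continuous_toProb (Y := KMet.of (ProkhorovSpace X))
    ProkhorovSpace.continuous_toProb

/-- Push-forward of measures as a non-expansive map. -/
noncomputable def map {X Y : KMet} (f : X ⟶ Y) :
    KMet.of (ProkhorovSpace X) ⟶ KMet.of (ProkhorovSpace Y) :=
  ⟨fun p => ⟨Giry.pushforward f.toFun (KMet.Hom.measurable f) p.toProb⟩,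
    LipschitzWith.of_dist_le_mul fun p q => by
      rw [NNReal.coe_one, one_mul]
      have hm := KMet.Hom.measurable f
      have hlt := fun ε (hε : dist p q < ε) =>
        (ENNReal.lt_ofReal_iff_toReal_lt (levyProkhorovEDist_ne_top
          (p.toProb : Measure X) q.toProb)).2
          ((prokhorovDist_eq_levyProkhorovDist p.toProb q.toProb).symm.trans_lt hε)
      refine (prokhorovDist_eq_levyProkhorovDist _ _).trans_le
        (levyProkhorovDist_le_of_forall_le _ _ dist_nonneg fun ε B hε hB => ?_)
      rw [Giry.toMeasure_pushforward, Giry.toMeasure_pushforward, Measure.map_apply hm hB,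
        Measure.map_apply hm Metric.isOpen_thickening.measurableSet]
      refine (left_measure_le_of_levyProkhorovEDist_lt (hlt ε hε) (hm hB)).trans ?_
      rw [ENNReal.toReal_ofReal (dist_nonneg.trans hε.le)]
      gcongr
      intro x hx
      obtain ⟨z, hz, hxz⟩ := Metric.mem_thickening_iff.1 hx
      refine Metric.mem_thickening_iff.2 ⟨f.toFun z, hz, lt_of_le_of_lt ?_ hxz⟩
      simpa using f.nonexpansive.dist_le_mul x z⟩

/-- The Prokhorov endofunctor: `P X` is the set of Borel probability measures on `X` with the
Prokhorov metric, with push-forwards. -/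
noncomputable def functor : KMet ⥤ KMet where
  obj X := KMet.of (ProkhorovSpace X)
  map f := map f
  map_id _ := KMet.Hom.ext (funext fun p => ProkhorovSpace.ext (Giry.pushforward_id p.toProb))
  map_comp f g := KMet.Hom.ext (funext fun p => ProkhorovSpace.ext
    (Giry.pushforward_pushforward (KMet.Hom.measurable f) (KMet.Hom.measurable g) p.toProb).symm)

/-- The natural transformation `H P ⟶ G H` which is the identity on the sets of Borel
probability measures. -/
noncomputable def toGiry : functor ⋙ borelFunctor ⟶ borelFunctor ⋙ Giry.monad.toFunctor where
  app X := ⟨ProkhorovSpace.toProb, measurable_toProb X⟩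
  naturality _ _ _ := rfl

end Prokhorov

/-! ### Probability endofunctors -/

/-- The category of probability endofunctors on `KMet`: objects are pairs `(S, β)` of an
endofunctor `S` of `KMet` and a natural transformation `β : H S ⟶ G H`; morphisms
`(S, β) ⟶ (S', β')` are natural transformations `γ : S ⟶ S'` with `β' ∘ H γ = β`. -/
abbrev ProbabilityEndofunctor :=
  CostructuredArrow ((Functor.whiskeringRight KMet KMet MeasCat).obj borelFunctor)
    (borelFunctor ⋙ Giry.monad.toFunctor)

namespace ProbabilityEndofunctor

/-- The probability endofunctor `(S, β)`. -/
noncomputable abbrev mk (S : KMet ⥤ KMet)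
    (β : S ⋙ borelFunctor ⟶ borelFunctor ⋙ Giry.monad.toFunctor) :
    ProbabilityEndofunctor :=
  CostructuredArrow.mk (S := (Functor.whiskeringRight KMet KMet MeasCat).obj borelFunctor)
    (Y := S) β

/-- The probability measure on `X` given by the component at `X` of the natural
transformation. -/
noncomputable def measureOf {S : KMet ⥤ KMet} (β : S ⋙ borelFunctor ⟶ borelFunctor ⋙ Giry.monad.toFunctor)
    (X : KMet) (s : S.obj X) : ProbabilityMeasure X :=
  (β.app X).1 s

/-- The component at `[0,1]` is non-expansive, as a map from `S [0,1]` to the probability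
measures on `[0,1]` with the Kantorovich metric. -/
def NonexpansiveAtInterval : ObjectProperty ProbabilityEndofunctor := fun Sβ =>
  ∀ s t : Sβ.left.obj KMet.interval,
    kantorovichDist (measureOf Sβ.hom KMet.interval s) (measureOf Sβ.hom KMet.interval t) ≤
      dist s t

end ProbabilityEndofunctor

/-- Kleisli laws `ℓ : H T ⟶ S H` between monads `T` on `D` and `S` on `C` along `H : D ⥤ C`. -/
structure IsKleisliLaw {D C : Type*} [Category D] [Category C] (H : D ⥤ C) (T : Monad D)
    (S : Monad C) (ℓ : T.toFunctor ⋙ H ⟶ H ⋙ S.toFunctor) : Prop where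
  unit (X : D) : H.map (T.η.app X) ≫ ℓ.app X = S.η.app (H.obj X)
  mul (X : D) : H.map (T.μ.app X) ≫ ℓ.app X =
    ℓ.app (T.obj X) ≫ S.map (ℓ.app X) ≫ S.μ.app (H.obj X)

/-- The condition that `t ↦ β t {0}` is an isomorphism `S 2 ≅ [0,1]` in `KMet`. -/
def EvalZeroIsIso {S : KMet ⥤ KMet}
    (β : S ⋙ borelFunctor ⟶ borelFunctor ⋙ Giry.monad.toFunctor) : Prop :=
  ∃ e : S.obj KMet.two ≅ KMet.interval, ∀ t : S.obj KMet.two,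
    KMet.coordinate (e.hom.toFun t) =
      (ProbabilityEndofunctor.measureOf β KMet.two t : Measure KMet.two).real {KMet.twoZero}

/-! ### Borel structures on spaces of probability measures -/

/-! Terminality. Since `Kantorovich.toGiry` is the identity on underlying sets, a morphism from `(S,
β)` can only be `s ↦ β_X(s)`. Naturality and compatibility with the transformations to the Giry
monad come for free, so only non-expansiveness of each component has to be shown. A non-expansive `h
: X → [0,1]` is itself an arrow of `KMet`, and naturality of `β` turns `∫ h dβ_X(s)` into the
integral of the coordinate function against `β_{[0,1]}((S h)(s))`. Hence the bound at `[0,1]` gives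
the bound at every `X` (`kantorovichDist_measureOf_le`).

Kleisli laws. An isomorphism `T 2 ≅ [0,1]` turns numbers into elements of `T 2`, and the
multiplication `T T 2 → T 2` then integrates. For non-expansive `h : [0,1] → [0,1]` the map `s ↦ ∫ h
dβ(s)` is a composite `T [0,1] → T T 2 → T 2 ≅ [0,1]` in `KMet`, so it is non-expansive, which is
what membership in the class requires. The terminal map respects unit and multiplication because `β`
does.

Isomorphisms with the Giry functor. The components are measurable bijections from a compact metric,
hence standard Borel, space into a countably separated one. By the Lusin–Souslin theorem their
inverses are measurable.

Prokhorov versus Kantorovich. Test functions `max 0 (α - d(·, A))` give `d_P² ≤ d_K`. The remaining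
claims are computations with measures supported on at most two points: moving mass `3/5` by `1/2`
makes `d_K < d_P`, while spreading `δ_0` evenly over `1/2` and `1` makes `d_P < d_K`. -/

/-- Probability measures on a countably generated space are separated by countably many
evaluations. -/
lemma countablySeparated_probabilityMeasure {X : Type*} [m : MeasurableSpace X]
    [MeasurableSpace.CountablyGenerated X] :
    MeasurableSpace.CountablySeparated (ProbabilityMeasure X) := by
  -- Unlike a bare generating set, the generated algebra is closed under intersections, so measures
  -- agreeing on it coincide; it is still countable.
  set C := generateSetAlgebra (MeasurableSpace.countableGeneratingSet X) with hC
  have hgen : m = MeasurableSpace.generateFrom C := by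
    rw [hC, generateFrom_generateSetAlgebra_eq,
      MeasurableSpace.generateFrom_countableGeneratingSet]
  have hCm : ∀ A ∈ C, MeasurableSet A := fun A hA => by
    rw [hgen]; exact MeasurableSpace.measurableSet_generateFrom hA
  -- Rational thresholds keep the separating family countable and still determine each real number
  -- `p A`.
  refine ⟨⟨⋃ A ∈ C, ⋃ r : ℚ, {{p : ProbabilityMeasure X | (p : Measure X).real A < r}},
    ?_, ?_, ?_⟩⟩
  · exact (countable_generateSetAlgebra
      (MeasurableSpace.countable_countableGeneratingSet (α := X))).biUnion
      fun A _ => Set.countable_iUnion fun r => Set.countable_singleton _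
  · simp only [Set.mem_iUnion, Set.mem_singleton_iff]
    rintro _ ⟨A, hA, r, rfl⟩
    exact (Giry.measurable_eval (hCm A hA)).ennreal_toReal measurableSet_Iio
  · intro p _ q _ h
    simp only [Set.mem_iUnion, Set.mem_singleton_iff] at h
    have hpq : ∀ A ∈ C, (p : Measure X) A = (q : Measure X) A := fun A hA => by
      have h' : ∀ r : ℚ, (p : Measure X).real A < r ↔ (q : Measure X).real A < r := fun r =>
        h _ ⟨A, hA, r, rfl⟩
      exact (measureReal_eq_measureReal_iff).1 (eq_of_forall_lt_rat_iff_lt h')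
    exact Subtype.ext (ext_of_generate_finite (μ := (p : Measure X)) (ν := (q : Measure X)) C hgen
      (fun s hs t ht _ => isSetAlgebra_generateSetAlgebra.inter_mem hs ht) hpq (by simp))

/-- A measurable bijection from a compact metric space onto the Borel probability measures on a
compact metric space is an isomorphism in `Meas`. -/
lemma isIso_of_bijective_probabilityMeasure {X Y : KMet}
    (φ : MeasCat.of Y ⟶ MeasCat.of (ProbabilityMeasure X)) (hb : Function.Bijective φ.1) :
    IsIso φ := by
  have := countablySeparated_probabilityMeasure (X := X)
  -- Lusin–Souslin: an injective measurable map from a standard Borel space to a countably separated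
  -- space sends measurable sets to measurable sets.
  have he : MeasurableEmbedding φ.1 := φ.2.measurableEmbedding hb.1
  let e := Equiv.ofBijective φ.1 hb
  refine ⟨⟨e.symm, fun s hs => ?_⟩, Subtype.ext (funext e.left_inv),
    Subtype.ext (funext e.right_inv)⟩
  rw [← e.image_eq_preimage_symm]
  exact he.measurableSet_image' hs

lemma Kantorovich.isIso_toGiry : IsIso Kantorovich.toGiry :=
  (NatTrans.isIso_iff_isIso_app _).2 fun X =>
    isIso_of_bijective_probabilityMeasure (Y := KMet.of (KantorovichSpace X)) _
      ⟨fun _ _ h => KantorovichSpace.ext h, fun p => ⟨⟨p⟩, rfl⟩⟩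

lemma Prokhorov.isIso_toGiry : IsIso Prokhorov.toGiry :=
  (NatTrans.isIso_iff_isIso_app _).2 fun X =>
    isIso_of_bijective_probabilityMeasure (Y := KMet.of (ProkhorovSpace X)) _
      ⟨fun _ _ h => ProkhorovSpace.ext h, fun p => ⟨⟨p⟩, rfl⟩⟩

/-! ### The coordinate function of the unit interval -/

lemma KMet.coordinate_mem (r : interval) : coordinate r ∈ Set.Icc (0 : ℝ) 1 := Subtype.property r

lemma KMet.dist_interval (x y : interval) : dist x y = |coordinate x - coordinate y| := rfl

lemma KMet.lipschitzWith_coordinate : LipschitzWith 1 coordinate :=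
  LipschitzWith.subtype_val _

/-! ### Terminality of the Kantorovich functor -/

namespace ProbabilityEndofunctor

lemma measureOf_map {S : KMet ⥤ KMet}
    (β : S ⋙ borelFunctor ⟶ borelFunctor ⋙ Giry.monad.toFunctor) {X Y : KMet} (f : X ⟶ Y)
    (s : S.obj X) :
    measureOf β Y ((S.map f).toFun s) =
      Giry.pushforward f.toFun (KMet.Hom.measurable f) (measureOf β X s) :=
  congrFun (congrArg Subtype.val (β.naturality f)) s

lemma measurable_measureOf {S : KMet ⥤ KMet}
    (β : S ⋙ borelFunctor ⟶ borelFunctor ⋙ Giry.monad.toFunctor) (X : KMet) :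
    Measurable (measureOf β X) := (β.app X).2

lemma kantorovich_nonexpansiveAtInterval :
    NonexpansiveAtInterval (mk Kantorovich.monad.toFunctor Kantorovich.toGiry) :=
  fun _ _ => le_rfl

/-- Each test function on `X` factors as an arrow to `[0,1]` followed by the coordinate function, so
naturality of `β` reduces the estimate to `[0,1]`, and `S.map f` does not increase distances. -/
lemma kantorovichDist_measureOf_le {S : KMet ⥤ KMet}
    {β : S ⋙ borelFunctor ⟶ borelFunctor ⋙ Giry.monad.toFunctor}
    (hβ : NonexpansiveAtInterval (mk S β)) (X : KMet) (s t : S.obj X) :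
    kantorovichDist (measureOf β X s) (measureOf β X t) ≤ dist s t := by
  refine kantorovichDist_le fun h hl hh => ?_
  let f : X ⟶ KMet.interval := ⟨fun x => (⟨h x, hh x⟩ : unitInterval),
    LipschitzWith.of_dist_le_mul fun x y => hl.dist_le_mul x y⟩
  have hint : ∀ u : S.obj X, ∫ x, h x ∂(measureOf β X u : Measure X) =
      ∫ r, KMet.coordinate r
        ∂(measureOf β KMet.interval ((S.map f).toFun u) : Measure KMet.interval) := fun u => by
    rw [measureOf_map, Kantorovich.integral_pushforward f _ KMet.lipschitzWith_coordinate]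
    rfl
  rw [hint, hint]
  refine (abs_integral_sub_le_kantorovichDist _ _ KMet.lipschitzWith_coordinate
    KMet.coordinate_mem).trans ((hβ _ _).trans ?_)
  simpa using (S.map f).nonexpansive.dist_le_mul s t

/-- The natural transformation to the Kantorovich functor given by a probability endofunctor which
is non-expansive at `[0,1]`. -/
noncomputable def toKantorovich {S : KMet ⥤ KMet}
    {β : S ⋙ borelFunctor ⟶ borelFunctor ⋙ Giry.monad.toFunctor}
    (hβ : NonexpansiveAtInterval (mk S β)) : S ⟶ Kantorovich.monad.toFunctor where
  app X := ⟨fun s => ⟨measureOf β X s⟩, LipschitzWith.of_dist_le_mul fun s t => by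
    rw [NNReal.coe_one, one_mul]
    exact kantorovichDist_measureOf_le hβ X s t⟩
  naturality _ _ f := KMet.Hom.ext (funext fun s =>
    KantorovichSpace.ext (measureOf_map β f s))

lemma toKantorovich_comp_toGiry {S : KMet ⥤ KMet}
    {β : S ⋙ borelFunctor ⟶ borelFunctor ⋙ Giry.monad.toFunctor}
    (hβ : NonexpansiveAtInterval (mk S β)) :
    Functor.whiskerRight (toKantorovich hβ) borelFunctor ≫ Kantorovich.toGiry = β :=
  NatTrans.ext (funext fun _ => rfl)

/-- The components of `Kantorovich.toGiry` are injective, so composing with it loses no information.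
This gives uniqueness both for endofunctors and for monads. -/
lemma eq_of_whiskerRight_comp_toGiry {S : KMet ⥤ KMet} {γ δ : S ⟶ Kantorovich.monad.toFunctor}
    (h : Functor.whiskerRight γ borelFunctor ≫ Kantorovich.toGiry =
      Functor.whiskerRight δ borelFunctor ≫ Kantorovich.toGiry) : γ = δ :=
  NatTrans.ext (funext fun X => KMet.Hom.ext (funext fun s => KantorovichSpace.ext
    (congrFun (congrArg Subtype.val (NatTrans.congr_app h X)) s)))

/-- The Kantorovich functor is terminal among the probability endofunctors which are non-expansive
at `[0,1]`. -/
noncomputable def kantorovichIsTerminal :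
    Limits.IsTerminal
      (⟨mk Kantorovich.monad.toFunctor Kantorovich.toGiry, kantorovich_nonexpansiveAtInterval⟩ :
        NonexpansiveAtInterval.FullSubcategory) :=
  Limits.IsTerminal.ofUniqueHom
    (fun Sβ => ObjectProperty.homMk (CostructuredArrow.homMk (toKantorovich Sβ.property)
      (toKantorovich_comp_toGiry Sβ.property)))
    fun Sβ m => ObjectProperty.hom_ext _ (CostructuredArrow.hom_ext _ _
      (eq_of_whiskerRight_comp_toGiry
        ((CostructuredArrow.w m.hom).trans (toKantorovich_comp_toGiry Sβ.property).symm)))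

end ProbabilityEndofunctor

/-! ### Kleisli laws and the two-point space -/

/-- The unit and multiplication of the Kantorovich monad are those of the Giry monad, read through
the identity on underlying sets. -/
lemma Kantorovich.isKleisliLaw_toGiry :
    IsKleisliLaw borelFunctor Kantorovich.monad Giry.monad Kantorovich.toGiry where
  unit _ := rfl
  mul _ := rfl

namespace KMet

/-- The point `1` of the two-point space. -/
def twoOne : two := (⟨1, by simp⟩ : ({0, 1} : Set ℝ))

lemma two_eq_or (x : two) : x = twoZero ∨ x = twoOne := by
  obtain ⟨x, rfl | rfl⟩ := (show ({0, 1} : Set ℝ) from x)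
  · exact Or.inl rfl
  · exact Or.inr rfl

lemma twoOne_ne_twoZero : twoOne ≠ twoZero := fun h =>
  one_ne_zero (congrArg (Subtype.val : ({0, 1} : Set ℝ) → ℝ) h)

lemma dist_twoZero_twoOne : dist twoZero twoOne = 1 := by
  change dist (0 : ℝ) 1 = 1
  simp

lemma dist_le_one (x y : two) : dist x y ≤ 1 := by
  rcases two_eq_or x with rfl | rfl <;> rcases two_eq_or y with rfl | rfl <;>
    simp [dist_twoZero_twoOne, dist_comm twoOne twoZero]

end KMet

lemma real_compl_twoZero (p : ProbabilityMeasure KMet.two) :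
    (p : Measure KMet.two).real {KMet.twoOne} = 1 - (p : Measure KMet.two).real {KMet.twoZero} := by
  rw [← probReal_compl_eq_one_sub (measurableSet_singleton _)]
  congr 1
  ext x
  rcases KMet.two_eq_or x with rfl | rfl <;>
    simp [KMet.twoOne_ne_twoZero, KMet.twoOne_ne_twoZero.symm]

lemma integral_two (p : ProbabilityMeasure KMet.two) (h : KMet.two → ℝ) :
    ∫ x, h x ∂(p : Measure KMet.two) =
      h KMet.twoOne + (p : Measure KMet.two).real {KMet.twoZero} *
        (h KMet.twoZero - h KMet.twoOne) := by
  classical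
  have hfin : (Set.univ : Set KMet.two) = (({KMet.twoZero, KMet.twoOne} : Finset KMet.two)) := by
    ext x
    simpa using KMet.two_eq_or x
  rw [← setIntegral_univ, hfin, setIntegral_finset _ (IntegrableOn.finset),
    Finset.sum_pair KMet.twoOne_ne_twoZero.symm, real_compl_twoZero]
  simp only [smul_eq_mul]
  ring

/-- By `integral_two` an integral is affine in the mass at `0`, with slope `h 0 - h 1`; a test
function has slope at most `1` in absolute value, and the distance to the point `1` attains it. -/
lemma kantorovichDist_two (p q : ProbabilityMeasure KMet.two) :
    kantorovichDist p q = |(p : Measure KMet.two).real {KMet.twoZero} -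
      (q : Measure KMet.two).real {KMet.twoZero}| := by
  refine le_antisymm (kantorovichDist_le fun h _ hh => ?_) ?_
  · have hle : |h KMet.twoZero - h KMet.twoOne| ≤ 1 :=
      abs_le.2 ⟨by linarith [(hh KMet.twoZero).1, (hh KMet.twoOne).2],
        by linarith [(hh KMet.twoZero).2, (hh KMet.twoOne).1]⟩
    rw [integral_two, integral_two, add_sub_add_left_eq_sub, ← sub_mul, abs_mul]
    exact mul_le_of_le_one_right (abs_nonneg _) hle
  · have hl : LipschitzWith 1 fun x : KMet.two => dist x KMet.twoOne :=
      LipschitzWith.dist_left _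
    have := abs_integral_sub_le_kantorovichDist p q hl
      fun x => ⟨dist_nonneg, KMet.dist_le_one _ _⟩
    rwa [integral_two, integral_two, dist_self, KMet.dist_twoZero_twoOne, sub_zero, mul_one,
      mul_one, zero_add, zero_add] at this

/-- The probability measure on the two-point space which gives weight `r` to `0`. -/
noncomputable def bernoulliTwo (r : KMet.interval) : ProbabilityMeasure KMet.two :=
  ⟨ENNReal.ofReal (KMet.coordinate r) • Measure.dirac KMet.twoZero +
    ENNReal.ofReal (1 - KMet.coordinate r) • Measure.dirac KMet.twoOne, ⟨by
      simp [← ENNReal.ofReal_add (KMet.coordinate_mem r).1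
        (sub_nonneg.2 (KMet.coordinate_mem r).2)]⟩⟩

lemma bernoulliTwo_real (r : KMet.interval) :
    (bernoulliTwo r : Measure KMet.two).real {KMet.twoZero} = KMet.coordinate r := by
  have : (bernoulliTwo r : Measure KMet.two) =
    ENNReal.ofReal (KMet.coordinate r) • Measure.dirac KMet.twoZero +
      ENNReal.ofReal (1 - KMet.coordinate r) • Measure.dirac KMet.twoOne := rfl
  simp [this, Measure.real, KMet.twoOne_ne_twoZero, (KMet.coordinate_mem r).1]

lemma Kantorovich.evalZeroIsIso_toGiry : EvalZeroIsIso Kantorovich.toGiry := by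
  have hreal : ∀ p : KantorovichSpace KMet.two,
      (p.toProb : Measure KMet.two).real {KMet.twoZero} ∈ Set.Icc (0 : ℝ) 1 :=
    fun p => ⟨measureReal_nonneg, measureReal_le_one⟩
  let f : KMet.of (KantorovichSpace KMet.two) ⟶ KMet.interval :=
    ⟨fun p => (⟨_, hreal p⟩ : unitInterval), LipschitzWith.of_dist_le_mul fun p q => by
      rw [NNReal.coe_one, one_mul]
      exact (kantorovichDist_two p.toProb q.toProb).ge⟩
  let g : KMet.interval ⟶ KMet.of (KantorovichSpace KMet.two) :=
    ⟨fun r => ⟨bernoulliTwo r⟩, LipschitzWith.of_dist_le_mul fun r s => by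
      rw [NNReal.coe_one, one_mul]
      refine (kantorovichDist_two (bernoulliTwo r) (bernoulliTwo s)).le.trans ?_
      rw [bernoulliTwo_real, bernoulliTwo_real]
      exact le_rfl⟩
  refine ⟨⟨f, g, KMet.Hom.ext (funext fun p => KantorovichSpace.ext ?_),
    KMet.Hom.ext (funext fun r => Subtype.ext (bernoulliTwo_real r))⟩, fun t => rfl⟩
  -- The distance formula shows that a measure on two points is determined by its mass at `0`.
  refine eq_of_kantorovichDist_eq_zero ?_
  rw [kantorovichDist_two, abs_eq_zero, sub_eq_zero]
  exact bernoulliTwo_real (⟨_, hreal p⟩ : unitInterval)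

/-! ### Van Breugel's class of monads -/

namespace IsKleisliLaw

open ProbabilityEndofunctor

variable {T : Monad KMet} {β : T.toFunctor ⋙ borelFunctor ⟶ borelFunctor ⋙ Giry.monad.toFunctor}

lemma measureOf_η (hβ : IsKleisliLaw borelFunctor T Giry.monad β) {X : KMet} (x : X) :
    measureOf β X ((T.η.app X).toFun x) = diracProba x :=
  congrFun (congrArg Subtype.val (hβ.unit X)) x

lemma measureOf_μ (hβ : IsKleisliLaw borelFunctor T Giry.monad β) {X : KMet}
    (s : T.obj (T.obj X)) :
    measureOf β X ((T.μ.app X).toFun s) =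
      Giry.average (Giry.pushforward _ (measurable_measureOf β X) (measureOf β (T.obj X) s)) :=
  congrFun (congrArg Subtype.val (hβ.mul X)) s

lemma nonexpansiveAtInterval (hβ : IsKleisliLaw borelFunctor T Giry.monad β)
    (h2 : EvalZeroIsIso β) : NonexpansiveAtInterval (ProbabilityEndofunctor.mk T.toFunctor β) := by
  obtain ⟨e, he⟩ := h2
  -- The inverse isomorphism encodes a number `r` as an element of `T 2` whose measure gives mass
  -- `r` to `0`.
  have he' : ∀ r : KMet.interval, (measureOf β KMet.two (e.inv.toFun r) : Measure KMet.two)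
      {KMet.twoZero} = ENNReal.ofReal (KMet.coordinate r) := fun r => by
    rw [← ENNReal.ofReal_toReal (measure_ne_top _ _)]
    congr 1
    have h1 : e.hom.toFun (e.inv.toFun r) = r :=
      congrFun (congrArg KMet.Hom.toFun e.inv_hom_id) r
    rw [← Measure.real, ← he, h1]
  intro (s : T.obj KMet.interval) (t : T.obj KMet.interval)
  change kantorovichDist (measureOf β KMet.interval s) (measureOf β KMet.interval t) ≤ dist s t
  refine kantorovichDist_le fun h hl hh => ?_
  let f : KMet.interval ⟶ KMet.interval := ⟨fun x => (⟨h x, hh x⟩ : unitInterval),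
    LipschitzWith.of_dist_le_mul fun x y => hl.dist_le_mul x y⟩
  -- Integration of `h` built from arrows of `KMet`: encode the values `h x` in `T 2`, average with
  -- the multiplication, and read off the mass at `0`.
  let F : T.obj KMet.interval ⟶ KMet.interval :=
    T.map (f ≫ e.inv) ≫ T.μ.app KMet.two ≫ e.hom
  have hF : ∀ u : T.obj KMet.interval, KMet.coordinate (F.toFun u) =
      ∫ x, h x ∂(measureOf β KMet.interval u : Measure KMet.interval) := fun u => by
    have h1 : KMet.coordinate (F.toFun u) = (measureOf β KMet.two ((T.μ.app KMet.two).toFun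
        ((T.map (f ≫ e.inv)).toFun u)) : Measure KMet.two).real {KMet.twoZero} := he _
    have hm := Giry.measurable_eval (X := KMet.two) (measurableSet_singleton KMet.twoZero)
    have hm' := hm.comp (measurable_measureOf β KMet.two)
    rw [h1, measureOf_μ hβ, measureOf_map, Measure.real,
      Giry.average_apply _ (measurableSet_singleton _), Giry.toMeasure_pushforward,
      lintegral_map hm (measurable_measureOf β KMet.two), Giry.toMeasure_pushforward,
      lintegral_map (f := fun y => (measureOf β KMet.two y : Measure KMet.two) {KMet.twoZero})
        hm' (KMet.Hom.measurable (f ≫ e.inv)),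
      integral_eq_lintegral_of_nonneg_ae (Filter.Eventually.of_forall fun x => (hh x).1)
        hl.continuous.measurable.aestronglyMeasurable]
    exact congrArg ENNReal.toReal (lintegral_congr fun x => he' (f.toFun x))
  rw [← hF, ← hF, ← KMet.dist_interval]
  simpa using F.nonexpansive.dist_le_mul s t

/-- The morphism of monads to the Kantorovich monad given by a Kleisli law. -/
noncomputable def toKantorovich (hβ : IsKleisliLaw borelFunctor T Giry.monad β)
    (hn : NonexpansiveAtInterval (ProbabilityEndofunctor.mk T.toFunctor β)) : T ⟶ Kantorovich.monad where
  toNatTrans := ProbabilityEndofunctor.toKantorovich hn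
  app_η X := KMet.Hom.ext (funext fun x => KantorovichSpace.ext (hβ.measureOf_η x))
  app_μ X := KMet.Hom.ext (funext fun s => KantorovichSpace.ext <| by
    refine (hβ.measureOf_μ s).trans (congrArg Giry.average ?_)
    -- Naturality of `β` along the component at `X` of the new transformation: pushing forward along
    -- this component and then forgetting the metric amounts to pushing forward along `β_X`, as in
    -- the law for `μ`.
    have h1 := measureOf_map β ((ProbabilityEndofunctor.toKantorovich hn).app X) s
    refine Eq.trans ?_ (congrArg (Giry.pushforward _ (Kantorovich.measurable_toProb X)) h1.symm)
    exact (Giry.pushforward_pushforward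
      (KMet.Hom.measurable ((ProbabilityEndofunctor.toKantorovich hn).app X))
      (Kantorovich.measurable_toProb X) (measureOf β (T.obj X) s)).symm)

lemma existsUnique_monadHom (hβ : IsKleisliLaw borelFunctor T Giry.monad β)
    (hn : NonexpansiveAtInterval (ProbabilityEndofunctor.mk T.toFunctor β)) :
    ∃! φ : T ⟶ Kantorovich.monad,
      Functor.whiskerRight φ.toNatTrans borelFunctor ≫ Kantorovich.toGiry = β :=
  ⟨toKantorovich hβ hn, toKantorovich_comp_toGiry hn, fun _ hφ =>
    MonadHom.ext' _ _ (congrArg NatTrans.app (eq_of_whiskerRight_comp_toGiry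
      (hφ.trans (toKantorovich_comp_toGiry hn).symm)))⟩

end IsKleisliLaw

/-! ### Comparison of the Kantorovich and Prokhorov distances -/

/-- If `α < d_P`, some `A` has `p A > q (A_α) + α`. The function `max 0 (α - d(·, A))` equals `α` on
`A`, is at most `α`, and vanishes off `A_α`, so its integrals differ by at least `α (p A - q (A_α))
> α²`. -/
lemma prokhorovDist_sq_le_kantorovichDist {X : Type*} [MetricSpace X] [MeasurableSpace X]
    [BorelSpace X] (p q : ProbabilityMeasure X) :
    prokhorovDist p q ^ 2 ≤ kantorovichDist p q := by
  have hbdd : BddBelow {α : ℝ | 0 < α ∧ ∀ A : Set X, MeasurableSet A →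
      (p : Measure X) A ≤ (q : Measure X) (Metric.cthickening α A) + ENNReal.ofReal α} :=
    ⟨0, fun α hα => hα.1.le⟩
  -- This keeps the height `α` of the test function at most `1`.
  have hle1 : prokhorovDist p q ≤ 1 := csInf_le hbdd ⟨one_pos, fun A _ =>
    prob_le_one.trans (by simp)⟩
  have hnn : 0 ≤ prokhorovDist p q := Real.sInf_nonneg fun α hα => hα.1.le
  have key : ∀ α, 0 < α → α < prokhorovDist p q → α ^ 2 ≤ kantorovichDist p q := by
    intro α hα hlt
    have hn : ¬ ∀ A : Set X, MeasurableSet A →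
        (p : Measure X) A ≤ (q : Measure X) (Metric.cthickening α A) + ENNReal.ofReal α :=
      fun H => notMem_of_lt_csInf hlt hbdd ⟨hα, H⟩
    push Not at hn
    obtain ⟨A, hA, hpq⟩ := hn
    -- `Metric.infDist` to the empty set is `0` by convention, so the test function would not vanish
    -- off the empty thickening.
    have hne : A.Nonempty := Set.nonempty_iff_ne_empty.2 fun h => by simp [h] at hpq
    have hreal : (q : Measure X).real (Metric.cthickening α A) + α < (p : Measure X).real A := by
      have := (ENNReal.toReal_lt_toReal (by finiteness) (by finiteness)).2 hpq
      rwa [ENNReal.toReal_add (by finiteness) (by finiteness),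
        ENNReal.toReal_ofReal hα.le] at this
    set h : X → ℝ := fun x => max 0 (α - Metric.infDist x A) with hh
    have hl : LipschitzWith 1 h := by
      have : LipschitzWith 1 fun x => α - Metric.infDist x A :=
        LipschitzWith.of_dist_le_mul fun x y => by
          rw [dist_sub_left]
          exact (Metric.lipschitz_infDist_pt A).dist_le_mul x y
      exact this.const_max 0
    have h0 : ∀ x, 0 ≤ h x := fun x => le_max_left _ _
    have hα' : ∀ x, h x ≤ α := fun x =>
      max_le hα.le (sub_le_self _ Metric.infDist_nonneg)
    have hb := abs_integral_sub_le_kantorovichDist p q hl fun x =>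
      ⟨h0 x, (hα' x).trans (hlt.le.trans hle1)⟩
    have hi : ∀ r : ProbabilityMeasure X, Integrable h (r : Measure X) := fun r =>
      Integrable.of_bound hl.continuous.measurable.aestronglyMeasurable α
        (Filter.Eventually.of_forall fun x => by
          rw [Real.norm_of_nonneg (h0 x)]; exact hα' x)
    have hp : α * (p : Measure X).real A ≤ ∫ x, h x ∂(p : Measure X) := by
      rw [mul_comm, ← smul_eq_mul, ← integral_indicator_const α hA]
      refine integral_mono ((integrable_const α).indicator hA) (hi p) fun x => ?_
      refine Set.indicator_le' (fun x hx => ?_) (fun x _ => h0 x) x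
      simp [hh, Metric.infDist_zero_of_mem hx]
    have hq : ∫ x, h x ∂(q : Measure X) ≤ α * (q : Measure X).real (Metric.cthickening α A) := by
      have hm : MeasurableSet (Metric.cthickening α A) := Metric.isClosed_cthickening.measurableSet
      rw [mul_comm, ← smul_eq_mul, ← integral_indicator_const α hm]
      refine integral_mono (hi q) ((integrable_const α).indicator hm) fun x => ?_
      refine Set.le_indicator (fun x _ => hα' x) (fun x hx => ?_) x
      refine max_le le_rfl (sub_nonpos.2 (le_of_not_ge fun hxA => hx ?_))
      exact Metric.mem_cthickening_iff.2
        ((ENNReal.le_ofReal_iff_toReal_le (Metric.infEDist_ne_top hne) hα.le).2 hxA)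
    nlinarith [le_abs_self (∫ x, h x ∂(p : Measure X) - ∫ x, h x ∂(q : Measure X))]
  have hk : 0 ≤ kantorovichDist p q :=
    (abs_nonneg _).trans (abs_integral_sub_le_kantorovichDist p q (h := fun _ => 0)
      (LipschitzWith.const' 0) (by simp))
  -- In square-root form the bound for all `α < d_P` passes to the limit directly.
  rw [← Real.le_sqrt hnn hk]
  refine le_of_forall_lt_imp_le_of_dense fun α hα => ?_
  rcases le_or_gt α 0 with h | h
  · exact h.trans (Real.sqrt_nonneg _)
  · exact (Real.le_sqrt h.le hk).2 (key α h hα)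

/-! ### Two-point measures and explicit distances on the unit interval -/

lemma prokhorovDist_le_of_forall {X : Type*} [MetricSpace X] [MeasurableSpace X]
    {p q : ProbabilityMeasure X} {α : ℝ} (hα : 0 < α) (h : ∀ A : Set X, MeasurableSet A →
      (p : Measure X) A ≤ (q : Measure X) (Metric.cthickening α A) + ENNReal.ofReal α) :
    prokhorovDist p q ≤ α :=
  csInf_le ⟨0, fun _ hβ => hβ.1.le⟩ ⟨hα, h⟩

/-- The probability measure with mass `a` at `x` and mass `b` at `y`. -/
noncomputable def twoPointMeasure {X : Type*} [MeasurableSpace X] (a b : ENNReal)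
    (hab : a + b = 1) (x y : X) : ProbabilityMeasure X :=
  ⟨a • Measure.dirac x + b • Measure.dirac y, ⟨by simp [hab]⟩⟩

lemma toMeasure_twoPointMeasure {X : Type*} [MeasurableSpace X] (a b : ENNReal)
    (hab : a + b = 1) (x y : X) :
    (twoPointMeasure a b hab x y : Measure X) = a • Measure.dirac x + b • Measure.dirac y := rfl

lemma integral_twoPointMeasure {X : Type*} [MeasurableSpace X] [MeasurableSingletonClass X]
    (a b : ENNReal) (hab : a + b = 1) (x y : X) (h : X → ℝ) :
    ∫ z, h z ∂(twoPointMeasure a b hab x y : Measure X) = a.toReal * h x + b.toReal * h y := by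
  have ha : a ≠ ⊤ := ne_top_of_le_ne_top ENNReal.one_ne_top (hab ▸ le_self_add)
  have hb : b ≠ ⊤ := ne_top_of_le_ne_top ENNReal.one_ne_top (hab ▸ le_add_self)
  rw [toMeasure_twoPointMeasure, integral_add_measure
    ((integrable_dirac (by simp)).smul_measure ha) ((integrable_dirac (by simp)).smul_measure hb),
    integral_smul_measure, integral_smul_measure, integral_dirac, integral_dirac]
  rfl

/-- The midpoint of the unit interval. -/
noncomputable def unitInterval.midpoint : unitInterval := ⟨1 / 2, by norm_num, by norm_num⟩

lemma three_fifths_add_two_fifths : (3 / 5 : ENNReal) + 2 / 5 = 1 := by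
  rw [← ENNReal.add_div, show (3 + 2 : ENNReal) = 5 by norm_num]
  exact ENNReal.div_self (by simp) (by simp)

lemma unitInterval.dist_midpoint_zero : dist midpoint 0 = 1 / 2 := by
  change dist (1 / 2 : ℝ) 0 = 1 / 2
  rw [Real.dist_eq, sub_zero, abs_of_pos (by norm_num)]

/-- The masses at `1` cancel, leaving `3/5 · |h 0 - h (1/2)| ≤ 3/10`, with equality for the
inclusion into the reals. -/
lemma kantorovichDist_three_fifths :
    kantorovichDist (twoPointMeasure _ _ three_fifths_add_two_fifths (0 : unitInterval) 1)
      (twoPointMeasure _ _ three_fifths_add_two_fifths unitInterval.midpoint 1) = 3 / 10 := by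
  refine le_antisymm (kantorovichDist_le fun h hl _ => ?_) ?_
  · have hd := hl.dist_le_mul unitInterval.midpoint 0
    rw [unitInterval.dist_midpoint_zero, Real.dist_eq, NNReal.coe_one, one_mul, abs_le] at hd
    rw [integral_twoPointMeasure, integral_twoPointMeasure]
    simp only [ENNReal.toReal_div, ENNReal.toReal_ofNat]
    rw [abs_le]
    constructor <;> linarith [hd.1, hd.2]
  · have hl : LipschitzWith 1 ((↑) : unitInterval → ℝ) := LipschitzWith.subtype_val _
    have := abs_integral_sub_le_kantorovichDist
      (twoPointMeasure _ _ three_fifths_add_two_fifths (0 : unitInterval) 1)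
      (twoPointMeasure _ _ three_fifths_add_two_fifths unitInterval.midpoint 1) hl fun x => x.2
    rw [integral_twoPointMeasure, integral_twoPointMeasure] at this
    refine le_trans ?_ this
    simp only [ENNReal.toReal_div, ENNReal.toReal_ofNat, unitInterval.midpoint,
      Set.Icc.coe_zero]
    rw [abs_sub_comm]
    exact le_trans (by norm_num) (le_abs_self _)

lemma two_fifths_le_half : (2 / 5 : ENNReal) ≤ ENNReal.ofReal (1 / 2) := by
  rw [← ENNReal.ofReal_toReal (a := 2 / 5) (by finiteness)]
  refine ENNReal.ofReal_le_ofReal ?_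
  simp only [ENNReal.toReal_div, ENNReal.toReal_ofNat]
  norm_num

lemma prokhorovDist_three_fifths :
    prokhorovDist (twoPointMeasure _ _ three_fifths_add_two_fifths (0 : unitInterval) 1)
      (twoPointMeasure _ _ three_fifths_add_two_fifths unitInterval.midpoint 1) = 1 / 2 := by
  refine le_antisymm (prokhorovDist_le_of_forall (by norm_num) fun A hA => ?_) ?_
  · rw [toMeasure_twoPointMeasure, toMeasure_twoPointMeasure]
    by_cases h0 : (0 : unitInterval) ∈ A
    · have hmid : unitInterval.midpoint ∈ Metric.cthickening (1 / 2) A :=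
        Metric.mem_cthickening_of_dist_le _ _ _ _ h0 unitInterval.dist_midpoint_zero.le
      calc ((3 / 5 : ENNReal) • Measure.dirac (0 : unitInterval) +
            (2 / 5 : ENNReal) • Measure.dirac 1 : Measure unitInterval) A
          ≤ (3 / 5 : ENNReal) + 2 / 5 := by
            simp only [Measure.add_apply, Measure.smul_apply, smul_eq_mul]
            gcongr <;> exact mul_le_of_le_one_right' prob_le_one
        _ ≤ _ := by
            -- The mass `3/5` is found at the midpoint; the mass `2/5` is absorbed by the additive
            -- error `1/2`.
            refine add_le_add ?_ two_fifths_le_half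
            rw [Measure.add_apply, Measure.smul_apply, Measure.dirac_apply_of_mem hmid,
              smul_eq_mul, mul_one]
            exact le_self_add
    · calc ((3 / 5 : ENNReal) • Measure.dirac (0 : unitInterval) +
            (2 / 5 : ENNReal) • Measure.dirac 1 : Measure unitInterval) A
          ≤ (2 / 5 : ENNReal) := by
            simp only [Measure.add_apply, Measure.smul_apply, smul_eq_mul,
              Measure.dirac_apply' _ hA, Set.indicator_of_notMem h0, mul_zero, zero_add]
            exact mul_le_of_le_one_right' (Set.indicator_le_self' (by simp) _)
        _ ≤ _ := two_fifths_le_half.trans le_add_self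
  · refine le_csInf ⟨1, one_pos, fun A _ => prob_le_one.trans (by simp)⟩ ?_
    rintro α ⟨hα, H⟩
    by_contra! hlt
    -- For `α < 1/2` the thickening of `{0}` misses both atoms of the second measure, which forces
    -- `3/5 ≤ α`.
    have h0 := H {0} (measurableSet_singleton _)
    have hmem : ∀ x : unitInterval, 1 / 2 ≤ (x : ℝ) → x ∉ Metric.cthickening α {0} := by
      intro x hx hx'
      rw [Metric.cthickening_singleton _ hα.le, Metric.mem_closedBall] at hx'
      have : dist x 0 = (x : ℝ) := by
        change dist (x : ℝ) 0 = x
        rw [Real.dist_eq, sub_zero, abs_of_nonneg x.2.1]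
      linarith
    have hmid := hmem unitInterval.midpoint le_rfl
    have hone := hmem 1 (by norm_num)
    simp only [toMeasure_twoPointMeasure, Measure.add_apply, Measure.smul_apply, smul_eq_mul,
      Measure.dirac_apply' _ (measurableSet_singleton _),
      Measure.dirac_apply' _ Metric.isClosed_cthickening.measurableSet,
      Set.indicator_of_notMem hmid, Set.indicator_of_notMem hone,
      Set.indicator_of_mem (Set.mem_singleton (0 : unitInterval)), mul_zero, zero_add,
      Pi.one_apply, mul_one] at h0
    have h1 : (3 / 5 : ENNReal) ≤ ENNReal.ofReal α := le_self_add.trans h0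
    rw [ENNReal.le_ofReal_iff_toReal_le (by finiteness) hα.le] at h1
    simp only [ENNReal.toReal_div, ENNReal.toReal_ofNat] at h1
    linarith

/-! ### Failure of non-expansiveness for the Prokhorov functor -/

/-- On three points of a line at distance `1/2`, the Dirac measure at the first point and the
uniform measure on the other two have Kantorovich distance greater than their Prokhorov
distance. -/
lemma prokhorovDist_lt_kantorovichDist {X : Type*} [MetricSpace X] [MeasurableSpace X]
    [BorelSpace X] {c : X → ℝ} (hl : LipschitzWith 1 c) (hc : ∀ x, c x ∈ Set.Icc (0 : ℝ) 1)
    {x y z : X} (hx : c x = 0) (hy : c y = 1 / 2) (hz : c z = 1) (hxy : dist y x = 1 / 2) :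
    prokhorovDist (diracProba x) (twoPointMeasure 2⁻¹ 2⁻¹ ENNReal.inv_two_add_inv_two y z) <
      kantorovichDist (diracProba x)
        (twoPointMeasure 2⁻¹ 2⁻¹ ENNReal.inv_two_add_inv_two y z) := by
  set q := twoPointMeasure 2⁻¹ 2⁻¹ ENNReal.inv_two_add_inv_two y z with hq
  have h2 : prokhorovDist (diracProba x) q ≤ 1 / 2 := by
    refine prokhorovDist_le_of_forall (by norm_num) fun A hA => ?_
    by_cases h0 : x ∈ A
    · have hmid : y ∈ Metric.cthickening (1 / 2) A :=
        Metric.mem_cthickening_of_dist_le _ _ _ _ h0 hxy.le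
      refine (prob_le_one (μ := (diracProba x : Measure X))).trans ?_
      -- Half of the mass is found at `y`, which lies in the thickening; the other half is the
      -- additive error.
      rw [← ENNReal.inv_two_add_inv_two]
      refine add_le_add ?_ (by simp)
      rw [hq, toMeasure_twoPointMeasure, Measure.add_apply, Measure.smul_apply,
        Measure.dirac_apply_of_mem hmid, smul_eq_mul, mul_one]
      exact le_self_add
    · simp [diracProba_toMeasure_apply' _ hA, h0]
  -- Testing with `c` gives `1/2 · 1/2 + 1/2 · 1 = 3/4`, which exceeds `1/2`.
  have h3 := abs_integral_sub_le_kantorovichDist (diracProba x) q hl hc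
  rw [hq, integral_twoPointMeasure, abs_sub_comm, ← hq] at h3
  have hp : ∫ x, c x ∂(diracProba x : Measure X) = 0 := (integral_dirac _ _).trans hx
  rw [hp, hy, hz] at h3
  simp only [ENNReal.toReal_inv, ENNReal.toReal_ofNat] at h3
  norm_num at h3 h2
  linarith

/-- The obstruction needs a pair with `d_P < d_K`: the points `0`, `1/2`, `1` of the interval
provide one. The pair with masses `3/5` and `2/5` has the opposite inequality. -/
lemma Prokhorov.not_nonexpansiveAtInterval :
    ¬ ProbabilityEndofunctor.NonexpansiveAtInterval
      (ProbabilityEndofunctor.mk Prokhorov.functor Prokhorov.toGiry) := by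
  intro H
  refine (prokhorovDist_lt_kantorovichDist (X := KMet.interval) (c := KMet.coordinate)
    (x := (0 : unitInterval)) (y := unitInterval.midpoint) (z := (1 : unitInterval))
    KMet.lipschitzWith_coordinate KMet.coordinate_mem rfl rfl rfl
    unitInterval.dist_midpoint_zero).not_ge ?_
  exact H (⟨_⟩ : ProkhorovSpace KMet.interval) (⟨_⟩ : ProkhorovSpace KMet.interval)

theorem mainTheorem4 :
    -- `(K, id)` is terminal among the probability endofunctors whose component at `[0,1]` is
    -- non-expansive
    (∃ hK : ProbabilityEndofunctor.NonexpansiveAtInterval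
        (ProbabilityEndofunctor.mk Kantorovich.monad.toFunctor Kantorovich.toGiry),
      Nonempty (Limits.IsTerminal
        (⟨ProbabilityEndofunctor.mk Kantorovich.monad.toFunctor Kantorovich.toGiry, hK⟩ :
          ProbabilityEndofunctor.NonexpansiveAtInterval.FullSubcategory))) ∧
    -- the class contains Van Breugel's class (to which `K` belongs), and one recovers the
    -- terminality of `K` as a monad in the latter
    (IsIso Kantorovich.toGiry ∧
      IsKleisliLaw borelFunctor Kantorovich.monad Giry.monad Kantorovich.toGiry ∧
      EvalZeroIsIso Kantorovich.toGiry) ∧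
    (∀ (T : Monad KMet) (β : T.toFunctor ⋙ borelFunctor ⟶ borelFunctor ⋙ Giry.monad.toFunctor),
      IsKleisliLaw borelFunctor T Giry.monad β → EvalZeroIsIso β →
        ProbabilityEndofunctor.NonexpansiveAtInterval
          (ProbabilityEndofunctor.mk T.toFunctor β) ∧
        ∃! φ : T ⟶ Kantorovich.monad,
          Functor.whiskerRight φ.toNatTrans borelFunctor ≫ Kantorovich.toGiry = β) ∧
    -- the Prokhorov endofunctor is not in the class
    (IsIso Prokhorov.toGiry ∧
      ¬ ProbabilityEndofunctor.NonexpansiveAtInterval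
        (ProbabilityEndofunctor.mk Prokhorov.functor Prokhorov.toGiry)) ∧
    -- the Prokhorov distance is not bounded by the Kantorovich distance, but its square is
    (∃ p q : ProbabilityMeasure unitInterval,
      (p : Measure unitInterval) =
        (3 / 5 : ENNReal) • Measure.dirac 0 + (2 / 5 : ENNReal) • Measure.dirac 1 ∧
      (q : Measure unitInterval) =
        (3 / 5 : ENNReal) • Measure.dirac ⟨1 / 2, by norm_num, by norm_num⟩ +
          (2 / 5 : ENNReal) • Measure.dirac 1 ∧
      kantorovichDist p q = 3 / 10 ∧ prokhorovDist p q = 1 / 2) ∧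
    (∀ (X : Type*) [MetricSpace X] [CompleteSpace X] [TopologicalSpace.SeparableSpace X]
      [MeasurableSpace X] [BorelSpace X] (p q : ProbabilityMeasure X),
      prokhorovDist p q ^ 2 ≤ kantorovichDist p q) := by
  refine ⟨⟨ProbabilityEndofunctor.kantorovich_nonexpansiveAtInterval,
      ⟨ProbabilityEndofunctor.kantorovichIsTerminal⟩⟩,
    ⟨Kantorovich.isIso_toGiry, Kantorovich.isKleisliLaw_toGiry, Kantorovich.evalZeroIsIso_toGiry⟩,
    fun T β hβ h2 => ?_, ⟨Prokhorov.isIso_toGiry, Prokhorov.not_nonexpansiveAtInterval⟩,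
    ⟨_, _, rfl, rfl, kantorovichDist_three_fifths, prokhorovDist_three_fifths⟩,
    fun X _ _ _ _ _ p q => prokhorovDist_sq_le_kantorovichDist p q⟩
  have hn := hβ.nonexpansiveAtInterval h2
  exact ⟨hn, hβ.existsUnique_monadHom hn⟩
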